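/- Let $H$ be an infinite dimensional complex Hilbert space (not necessarily separable) and let $A$ be a bounded linear operator on $H$. Then: (i) there are an integer $m$ with $1\le m\le 4$ and bounded linear operators $N_1,\dots,N_m$ on $H$, each nilpotent of nilpotency index at most $3$ (that is, $N_i^3=0$), such that $A=N_1+\dots+N_m$; (ii) there are an integer $m$ with $1\le m\le 4$ and automorphisms $U_1,\dots,U_m$ of $H$ (that is, bounded linear bijections $H\to H$ with bounded inverse), each of order exactly $3$ (that is, $U_i^3=1$ and $U_i\ne 1$), such that $A=U_1+\dots+U_m$. -/

import Mathlib

/-!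
Both parts are instances of one statement: for any scalars `μ 0, μ 1, μ 2`, every bounded operator
`A` on `H` is a sum of four operators annihilated by `p = (X - μ 0) (X - μ 1) (X - μ 2)`. The choice
`μ = 0` gives nilpotents with vanishing cube, and `μ = (1, ω, ω²)` with `ω` a primitive cube root of
unity gives operators with `U ^ 3 = 1`.

The only analytic input is `H ≃ ℓ²(ℕ, H)`, valid for every infinite-dimensional Hilbert space. It
gives operators `s 0, s 1, t 0, t 1` with `t i * s j = δ i j` and `∑ i, s i * t i = 1`
(`CuntzFamily`), so that operators on `H` can be written as `2 × 2` or, after one more splitting,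
`3 × 3` block matrices over the same ring. Moreover, the diagonal operator `d = diag (a, a, a, …)`
satisfies `d = s 0 * a * t 0 + s 1 * d * t 1`. The rest is algebra.

* Triangular part. If all the diagonal blocks of a `3 × 3` block matrix `B` are the scalars `2 μ i`,
  then `B` is the sum of an upper and a lower triangular matrix with diagonal `μ`, and both are
  annihilated by `p` (`CuntzFamily.exists_add_of_diag`).
* Rank-one part. A matrix `μ 0 + u v`, with `u` a column and `v` a row, is annihilated by `p` as soon
  as `g = v u` satisfies `(g - (μ 1 - μ 0)) (g - (μ 2 - μ 0)) = 0`
  (`aeval_algebraMap_add_mul_eq_zero`). Two such matrices have to bring the diagonal of `A` to `2 μ`.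
  With `u = (1, 1, 1)` in the first and `(w, y, 1)` as the column of the second, this amounts to
  writing one ring element, the sum of the corrected diagonal blocks of `A`, as
  `g + h + [w, x] + [y, z]`, where `g` and `h` satisfy the quadratic equation above.
* Commutator part. Such an expression exists for every element `T`
  (`CuntzFamily.exists_eq_add_commutators`): in `2 × 2` blocks the off-diagonal entries of `T` are
  absorbed in `g` and `h`, one commutator moves the lower diagonal entry to the upper corner, and
  what remains, `s 0 * a * t 0 = d - s 1 * d * t 1`, is the commutator `[t 1, s 1 * d]`.
-/

open Polynomial
open scoped ENNReal

/-! ### Block decompositions of a ring -/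

/-- Elements `s i`, `t i` of a ring `R` satisfying the Cuntz relations. They identify `R` with the
matrices over `R` indexed by `ι`: the `(i, j)` block of `a` is `t i * a * s j`. -/
structure CuntzFamily (ι R : Type*) [Fintype ι] [DecidableEq ι] [Ring R] where
  s : ι → R
  t : ι → R
  t_mul_s : ∀ i j, t i * s j = if i = j then 1 else 0
  sum_s_mul_t : ∑ i, s i * t i = 1

namespace CuntzFamily

variable {R : Type*} [Ring R]

section Blocks

variable {ι : Type*} [Fintype ι] [DecidableEq ι]

theorem eq_sum_blocks (c : CuntzFamily ι R) (B : R) :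
    B = ∑ i, ∑ j, c.s i * (c.t i * B * c.s j) * c.t j := by
  calc B = (∑ i, c.s i * c.t i) * B * ∑ j, c.s j * c.t j := by simp [c.sum_s_mul_t]
    _ = _ := by simp only [Finset.sum_mul, Finset.mul_sum, mul_assoc]; exact Finset.sum_comm

theorem sum_mul_s (c : CuntzFamily ι R) (x : ι → R) (j : ι) :
    (∑ i, x i * c.t i) * c.s j = x j := by
  simp [Finset.sum_mul, mul_assoc, c.t_mul_s]

theorem t_mul_sum (c : CuntzFamily ι R) (x : ι → R) (j : ι) :
    c.t j * (∑ i, c.s i * x i) = x j := by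
  simp [Finset.mul_sum, ← mul_assoc, c.t_mul_s]

end Blocks

/-- Splitting the second summand of a two-fold block decomposition in two again. -/
def splitLast (c : CuntzFamily (Fin 2) R) : CuntzFamily (Fin 3) R where
  s := ![c.s 0, c.s 1 * c.s 0, c.s 1 * c.s 1]
  t := ![c.t 0, c.t 0 * c.t 1, c.t 1 * c.t 1]
  t_mul_s i j := by
    have h (a b : R) (i j : Fin 2) : a * c.t i * (c.s j * b) = if i = j then a * b else 0 := by
      rw [mul_assoc, ← mul_assoc (c.t i), c.t_mul_s]; split_ifs <;> simp
    have h' (b : R) (i j : Fin 2) : c.t i * (c.s j * b) = if i = j then b else 0 := by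
      simpa using h 1 b i j
    have h'' (a : R) (i j : Fin 2) : a * c.t i * c.s j = if i = j then a else 0 := by
      simpa using h a 1 i j
    fin_cases i <;> fin_cases j <;> simp [h, h', h'', c.t_mul_s]
  sum_s_mul_t := by
    have h := c.sum_s_mul_t
    rw [Fin.sum_univ_two] at h
    rw [Fin.sum_univ_three]
    simp only [Matrix.cons_val]
    calc _ = c.s 0 * c.t 0 + c.s 1 * (c.s 0 * c.t 0 + c.s 1 * c.t 1) * c.t 1 := by noncomm_ring
      _ = 1 := by rw [h, mul_one, h]

/-! ### Matrices with scalar diagonal -/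

section Algebra

variable {k : Type*} [Field k] [Algebra k R]

/-- A block triangular matrix with scalar diagonal `μ`, for the ordering `σ` of the index set, is
annihilated by its characteristic polynomial, although the other blocks need not commute. -/
theorem aeval_eq_zero_of_triangular (c : CuntzFamily (Fin 3) R) (σ : Equiv.Perm (Fin 3))
    (μ : Fin 3 → k) (N x y z : R)
    (h0 : N * c.s (σ 0) = μ (σ 0) • c.s (σ 0))
    (h1 : N * c.s (σ 1) = μ (σ 1) • c.s (σ 1) + c.s (σ 0) * x)
    (h2 : N * c.s (σ 2) = μ (σ 2) • c.s (σ 2) + c.s (σ 0) * y + c.s (σ 1) * z) :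
    aeval N (∏ i, (X - C (μ i))) = 0 := by
  have hp : (∏ i, (X - C (μ i))) =
      (X - C (μ (σ 0))) * (X - C (μ (σ 1))) * (X - C (μ (σ 2))) := by
    rw [← Equiv.prod_comp σ, Fin.prod_univ_three]
  have key : ∀ i, aeval N (∏ i, (X - C (μ i))) * c.s (σ i) = 0 := by
    have e0 : aeval N (X - C (μ (σ 0))) * c.s (σ 0) = 0 := by
      simp [sub_mul, h0, Algebra.algebraMap_eq_smul_one]
    have e1 : aeval N (X - C (μ (σ 1))) * c.s (σ 1) = c.s (σ 0) * x := by
      simp [sub_mul, h1, Algebra.algebraMap_eq_smul_one]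
    have e2 : aeval N (X - C (μ (σ 2))) * c.s (σ 2) = c.s (σ 0) * y + c.s (σ 1) * z := by
      simp [sub_mul, h2, Algebra.algebraMap_eq_smul_one, add_assoc]
    have e01 (x : R) : aeval N ((X - C (μ (σ 0))) * (X - C (μ (σ 1)))) * (c.s (σ 0) * x) = 0 := by
      rw [mul_comm (X - C _), map_mul, ← mul_assoc, mul_assoc (aeval N _), e0]; simp
    have e01' (x : R) :
        aeval N ((X - C (μ (σ 0))) * (X - C (μ (σ 1)))) * (c.s (σ 1) * x) = 0 := by
      rw [map_mul, ← mul_assoc, mul_assoc (aeval N _), e1, ← mul_assoc, e0]; simp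
    intro i
    rw [hp]
    fin_cases i
    · simp only [Fin.zero_eta]
      rw [mul_comm, map_mul, mul_assoc, ← mul_one (c.s _), e01, mul_zero]
    · simp only [Fin.mk_one]
      rw [mul_comm, map_mul, mul_assoc, ← mul_one (c.s _), e01', mul_zero]
    · simp only [Fin.reduceFinMk]
      rw [map_mul, mul_assoc, e2, mul_add, e01, e01', add_zero]
  rw [← mul_one (aeval N _), ← c.sum_s_mul_t, Finset.mul_sum]
  refine Finset.sum_eq_zero fun i _ => ?_
  have := key (σ.symm i)
  rw [Equiv.apply_symm_apply] at this
  rw [← mul_assoc, this, zero_mul]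

/-- A block matrix with diagonal `2 μ` is the sum of an upper and a lower triangular one, each with
diagonal `μ`. -/
theorem exists_add_of_diag [Nontrivial R] (c : CuntzFamily (Fin 3) R) (μ : Fin 3 → k) (B : R)
    (hB : ∀ i, c.t i * B * c.s i = (2 * μ i) • 1) :
    ∃ M N : R, (aeval M (∏ i, (X - C (μ i))) = 0 ∧ (μ 1 ≠ μ 0 → M ≠ algebraMap k R (μ 0))) ∧
      (aeval N (∏ i, (X - C (μ i))) = 0 ∧ (μ 1 ≠ μ 0 → N ≠ algebraMap k R (μ 0))) ∧ B = M + N := by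
  -- The middle diagonal block of each summand is `μ 1`, which excludes the scalar `μ 0`.
  have ne {N y : R} (i : Fin 3) (hi : i ≠ 1) (h : N * c.s 1 = μ 1 • c.s 1 + c.s i * y) :
      μ 1 ≠ μ 0 → N ≠ algebraMap k R (μ 0) := by
    rintro hμ rfl
    have := congrArg (c.t 1 * ·) h
    simp only [mul_add, ← mul_assoc, mul_smul_comm, c.t_mul_s, hi.symm,
      Algebra.algebraMap_eq_smul_one, smul_mul_assoc, mul_one, if_true, if_false, zero_mul, add_zero] at this
    rw [← sub_eq_zero, ← sub_smul, smul_eq_zero] at this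
    exact this.elim (fun h => hμ (sub_eq_zero.1 h).symm) one_ne_zero
  let b (i j : Fin 3) : R := c.t i * B * c.s j
  let m : Fin 3 → R := ![μ 0 • c.s 0, μ 1 • c.s 1 + c.s 0 * b 0 1,
    μ 2 • c.s 2 + c.s 0 * b 0 2 + c.s 1 * b 1 2]
  let n : Fin 3 → R := ![μ 0 • c.s 0 + c.s 2 * b 2 0 + c.s 1 * b 1 0, μ 1 • c.s 1 + c.s 2 * b 2 1,
    μ 2 • c.s 2]
  have hm := c.sum_mul_s m
  have hn := c.sum_mul_s n
  refine ⟨∑ i, m i * c.t i, ∑ i, n i * c.t i,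
    ⟨c.aeval_eq_zero_of_triangular 1 μ _ (b 0 1) (b 0 2) (b 1 2) (hm 0) (hm 1) (hm 2),
      ne 0 (by decide) (hm 1)⟩,
    ⟨c.aeval_eq_zero_of_triangular (Equiv.swap 0 2) μ _ (b 2 1) (b 2 0) (b 1 0) (hn 2) (hn 1) (hn 0),
      ne 2 (by decide) (hn 1)⟩, ?_⟩
  conv_lhs => rw [c.eq_sum_blocks B]
  simp only [Fin.sum_univ_three, hB, m, n, b, Matrix.cons_val, two_mul, add_smul, mul_add, add_mul,
    mul_smul_comm, smul_mul_assoc, mul_one]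
  abel

end Algebra

end CuntzFamily

/-! ### Scalars plus products with a quadratic relation -/

section RankOne

variable {k R : Type*} [Field k] [Ring R] [Algebra k R]

/-- `u * v` satisfies the equation of `v * u`, multiplied by one more factor `u * v`. -/
theorem aeval_algebraMap_add_mul_eq_zero (μ : Fin 3 → k) (u v : R)
    (h : (v * u - algebraMap k R (μ 1 - μ 0)) * (v * u - algebraMap k R (μ 2 - μ 0)) = 0) :
    aeval (algebraMap k R (μ 0) + u * v) (∏ i, (X - C (μ i))) = 0 := by
  have e : ∀ a : R, (∀ x, a * x = x * a) → (u * v - a) * u = u * (v * u - a) := fun a ha => by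
    rw [sub_mul, mul_sub, ha, mul_assoc]
  have h0 : aeval (algebraMap k R (μ 0) + u * v) (X - C (μ 0)) = u * v := by simp
  have h1 (i) : aeval (algebraMap k R (μ 0) + u * v) (X - C (μ i)) =
      u * v - algebraMap k R (μ i - μ 0) := by simp; abel
  have hp : (∏ i, (X - C (μ i))) = (X - C (μ 1)) * (X - C (μ 2)) * (X - C (μ 0)) := by
    rw [Fin.prod_univ_three]; ring
  calc aeval (algebraMap k R (μ 0) + u * v) (∏ i, (X - C (μ i)))
      = (u * v - algebraMap k R (μ 1 - μ 0)) *
          ((u * v - algebraMap k R (μ 2 - μ 0)) * u) * v := by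
        rw [hp, map_mul, map_mul, h0, h1, h1]; simp only [mul_assoc]
    _ = u * ((v * u - algebraMap k R (μ 1 - μ 0)) *
          (v * u - algebraMap k R (μ 2 - μ 0))) * v := by
        rw [e _ (Algebra.commutes _), ← mul_assoc, e _ (Algebra.commutes _), mul_assoc u]
    _ = 0 := by rw [h, mul_zero, zero_mul]

theorem mul_ne_zero_of_quadratic [Nontrivial R] {α β : k} (hα : α ≠ 0) (hβ : β ≠ 0) (u v : R)
    (h : (v * u - algebraMap k R α) * (v * u - algebraMap k R β) = 0) : u * v ≠ 0 := by
  intro huv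
  have hg : v * u * (v * u) = 0 := by rw [mul_assoc, ← mul_assoc u, huv]; simp
  generalize v * u = g at h hg
  -- As `g ^ 2 = 0`, multiplying the quadratic equation by `g` leaves only its constant term.
  have h1 : (β * α) • g = g * ((g - algebraMap k R α) * (g - algebraMap k R β)) := by
    simp [Algebra.algebraMap_eq_smul_one, sub_mul, mul_sub, hg, smul_smul]
  rw [h, mul_zero, smul_eq_zero, or_iff_right (mul_ne_zero hβ hα)] at h1
  rw [h1, zero_sub, zero_sub, neg_mul_neg, ← map_mul, Algebra.algebraMap_eq_smul_one,
    smul_eq_zero] at h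
  exact h.elim (mul_ne_zero hα hβ) one_ne_zero

end RankOne

/-! ### Sums of two quadratic elements and two commutators -/

namespace CuntzFamily

variable {k R : Type*} [Field k] [Ring R] [Algebra k R]

/-- The hypothesis `hc` makes every corner element `s 0 * a * t 0` a commutator. -/
theorem exists_eq_add_commutators (c : CuntzFamily (Fin 2) R)
    (hc : ∀ a, ∃ d, d = c.s 0 * a * c.t 0 + c.s 1 * d * c.t 1) (α β : k) (T : R) :
    ∃ g h w x y z : R, (g - algebraMap k R α) * (g - algebraMap k R β) = 0 ∧
      (h - algebraMap k R α) * (h - algebraMap k R β) = 0 ∧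
      T = g + h + (w * x - x * w) + (y * z - z * y) := by
  have hts (a : R) (i j : Fin 2) : c.t i * (c.s j * a) = if i = j then a else 0 := by
    rw [← mul_assoc, c.t_mul_s]; split_ifs <;> simp
  have h1 : (1 : R) = c.s 0 * c.t 0 + c.s 1 * c.t 1 := by
    rw [← c.sum_s_mul_t, Fin.sum_univ_two]
  have ha (γ : k) : algebraMap k R γ = γ • (c.s 0 * c.t 0) + γ • (c.s 1 * c.t 1) := by
    rw [Algebra.algebraMap_eq_smul_one, h1, smul_add]
  have e1 (r : R) : α • (c.s 0 * c.t 0) + β • (c.s 1 * c.t 1) + r -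
      (α • (c.s 0 * c.t 0) + α • (c.s 1 * c.t 1)) = (β - α) • (c.s 1 * c.t 1) + r := by
    rw [sub_smul]; abel
  have e2 (r : R) : α • (c.s 0 * c.t 0) + β • (c.s 1 * c.t 1) + r -
      (β • (c.s 0 * c.t 0) + β • (c.s 1 * c.t 1)) = (α - β) • (c.s 0 * c.t 0) + r := by
    rw [sub_smul]; abel
  -- The diagonal blocks of `T - g - h`, where `g` and `h` both have diagonal `(α, β)`.
  let p : R := c.t 0 * T * c.s 0 - (2 * α) • 1
  let q : R := c.t 1 * T * c.s 1 - (2 * β) • 1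
  obtain ⟨d, hd⟩ := hc (p + q)
  refine ⟨α • (c.s 0 * c.t 0) + β • (c.s 1 * c.t 1) + c.s 0 * (c.t 0 * T * c.s 1) * c.t 1,
    α • (c.s 0 * c.t 0) + β • (c.s 1 * c.t 1) + c.s 1 * (c.t 1 * T * c.s 0) * c.t 0,
    c.t 1, c.s 1 * d, c.s 1 * q * c.t 0, c.s 0 * c.t 1, ?_, ?_, ?_⟩
  · rw [ha, ha, e1, e2]
    simp [mul_add, add_mul, mul_assoc, hts]
  -- `h` is lower triangular: the product that visibly vanishes has the factors in the other order.
  · rw [(((Commute.refl _).sub_left (Algebra.commute_algebraMap_left α _)).sub_right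
      (Algebra.commute_algebraMap_right β _)).eq, ha, ha, e1, e2]
    simp [mul_add, add_mul, mul_assoc, hts]
  · have hpq : c.t 1 * (c.s 1 * d) - c.s 1 * d * c.t 1 = c.s 0 * (p + q) * c.t 0 := by
      rw [hts, if_pos rfl, sub_eq_iff_eq_add, ← hd]
    have hq : c.s 1 * q * c.t 0 * (c.s 0 * c.t 1) - c.s 0 * c.t 1 * (c.s 1 * q * c.t 0) =
        c.s 1 * q * c.t 1 - c.s 0 * q * c.t 0 := by
      simp [mul_assoc, hts]
    rw [hpq, hq]
    conv_lhs => rw [c.eq_sum_blocks T]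
    simp only [Fin.sum_univ_two, p, q, mul_sub, sub_mul, mul_add, add_mul, mul_smul_comm,
      smul_mul_assoc, mul_one, two_mul, add_smul]
    abel

/-! ### Sums of four elements annihilated by a cubic polynomial -/

/-- In a ring absorbing countable block sums, every element is a sum of four elements annihilated by
a given split cubic polynomial. If `μ 0` is a simple root, none of the four is the scalar `μ 0`; this
is what makes the order of the automorphisms exactly `3`. -/
theorem exists_eq_sum_four [Nontrivial R] (c : CuntzFamily (Fin 2) R)
    (hc : ∀ a, ∃ d, d = c.s 0 * a * c.t 0 + c.s 1 * d * c.t 1) (μ : Fin 3 → k) (A : R) :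
    ∃ N : Fin 4 → R, (∀ i, aeval (N i) (∏ i, (X - C (μ i))) = 0 ∧
      (μ 1 ≠ μ 0 → μ 2 ≠ μ 0 → N i ≠ algebraMap k R (μ 0))) ∧
      A = ∑ i, N i := by
  let e := c.splitLast
  have dot (x y : Fin 3 → R) : (∑ i, x i * e.t i) * (∑ i, e.s i * y i) = ∑ i, x i * y i := by
    simp only [Finset.sum_mul, mul_assoc, e.t_mul_sum]
  obtain ⟨g, h, w, x, y, z, hg, hh, hT⟩ := c.exists_eq_add_commutators hc (μ 1 - μ 0) (μ 2 - μ 0)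
    (∑ i, (e.t i * A * e.s i - (2 * μ i) • (1 : R) - (2 * μ 0) • 1))
  -- The last entry of `a` is `1`, so the last entry of `b` can be chosen to make the product of the
  -- row `b` and the column `a` equal to `h`.
  let a : Fin 3 → R := ![w, y, 1]
  let b : Fin 3 → R := ![x, z, h - x * w - z * y]
  -- The row `v`, against the column `(1, 1, 1)`, corrects the diagonal of `A` to `2 μ`; its product
  -- with that column is the sum of its entries, which is `g`.
  let v : Fin 3 → R := fun i =>
    e.t i * A * e.s i - (2 * μ i) • (1 : R) - (2 * μ 0) • 1 - a i * b i
  have hba : (∑ i, b i * e.t i) * (∑ i, e.s i * a i) = h := by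
    rw [dot, Fin.sum_univ_three]; simp [a, b]
  have hv : (∑ i, v i * e.t i) * (∑ i, e.s i * 1) = g := by
    rw [dot]
    simp only [v, mul_one]
    rw [Finset.sum_sub_distrib, hT, Fin.sum_univ_three]
    simp only [a, b, Matrix.cons_val, one_mul]
    abel
  rw [← hv] at hg
  rw [← hba] at hh
  obtain ⟨M, N, hM, hN, hB⟩ := e.exists_add_of_diag μ
    (A - (algebraMap k R (μ 0) + (∑ i, e.s i * 1) * ∑ i, v i * e.t i) -
      (algebraMap k R (μ 0) + (∑ i, e.s i * a i) * ∑ i, b i * e.t i)) (fun i => by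
        have hr (x y : Fin 3 → R) : e.t i * ((∑ i, e.s i * x i) * ∑ i, y i * e.t i) * e.s i =
            x i * y i := by
          rw [← mul_assoc, e.t_mul_sum, mul_assoc, e.sum_mul_s]
        rw [mul_sub, mul_sub, sub_mul, sub_mul, mul_add, mul_add, add_mul, add_mul, hr, hr]
        simp only [Algebra.algebraMap_eq_smul_one, mul_smul_comm, smul_mul_assoc, mul_one,
          e.t_mul_s, if_true, one_mul, v, two_mul, add_smul]
        abel)
  refine ⟨![M, N, algebraMap k R (μ 0) + (∑ i, e.s i * 1) * ∑ i, v i * e.t i,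
    algebraMap k R (μ 0) + (∑ i, e.s i * a i) * ∑ i, b i * e.t i], ?_, ?_⟩
  rotate_left
  · rw [Fin.sum_univ_four]
    simp only [Matrix.cons_val]
    rw [← hB]
    abel
  intro i
  fin_cases i
  · exact ⟨hM.1, fun h _ => hM.2 h⟩
  · exact ⟨hN.1, fun h _ => hN.2 h⟩
  · exact ⟨aeval_algebraMap_add_mul_eq_zero μ _ _ hg,
      fun h1 h2 => add_eq_left.not.2
        (mul_ne_zero_of_quadratic (sub_ne_zero.2 h1) (sub_ne_zero.2 h2) _ _ hg)⟩
  · exact ⟨aeval_algebraMap_add_mul_eq_zero μ _ _ hh,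
      fun h1 h2 => add_eq_left.not.2
        (mul_ne_zero_of_quadratic (sub_ne_zero.2 h1) (sub_ne_zero.2 h2) _ _ hh)⟩

end CuntzFamily

/-! ### Shifts on square-summable sequences -/

/-- The sequence `0, f 0, f 1, …`. -/
def consZero {E : Type*} [Zero E] (f : ℕ → E) : ℕ → E
  | 0 => 0
  | n + 1 => f n

theorem summable_consZero {E : Type*} [NormedAddCommGroup E] (f : lp (fun _ : ℕ => E) 2) :
    Summable fun n => ‖consZero (⇑f) n‖ ^ (2 : ℝ≥0∞).toReal :=
  (summable_nat_add_iff 1).1 ((lp.memℓp f).summable (by simp))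

section Shift

variable (E : Type*) [NormedAddCommGroup E] [NormedSpace ℂ E]

/-- The backward shift `(f 0, f 1, …) ↦ (f 1, f 2, …)`. -/
noncomputable def leftShift : lp (fun _ : ℕ => E) 2 →L[ℂ] lp (fun _ : ℕ => E) 2 :=
  LinearMap.mkContinuous
    { toFun f := ⟨fun n => f (n + 1), memℓp_gen
        (((lp.memℓp f).summable (by simp)).comp_injective (add_left_injective 1))⟩
      map_add' _ _ := rfl
      map_smul' _ _ := rfl }
    1 fun f => by
      refine lp.norm_le_of_tsum_le (by simp) (by positivity) ?_
      rw [one_mul, lp.norm_rpow_eq_tsum (by simp)]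
      exact tsum_comp_le_tsum_of_inj ((lp.memℓp f).summable (by simp))
        (fun _ => by positivity) (add_left_injective 1)

/-- The forward shift `(f 0, f 1, …) ↦ (0, f 0, f 1, …)`. -/
noncomputable def rightShift : lp (fun _ : ℕ => E) 2 →L[ℂ] lp (fun _ : ℕ => E) 2 :=
  LinearMap.mkContinuous
    { toFun f := ⟨consZero (⇑f), memℓp_gen (summable_consZero f)⟩
      map_add' f g := lp.ext <| funext fun n => by
        cases n
        exacts [(add_zero (0 : E)).symm, rfl]
      map_smul' r f := lp.ext <| funext fun n => by
        cases n
        exacts [(smul_zero r).symm, rfl] }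
    1 fun f => by
      refine lp.norm_le_of_tsum_le (by simp) (by positivity) ?_
      rw [one_mul, lp.norm_rpow_eq_tsum (by simp)]
      refine (summable_consZero f).tsum_eq_zero_add.trans_le ?_
      simp [consZero]

@[simp]
theorem leftShift_apply (f : lp (fun _ : ℕ => E) 2) (n : ℕ) :
    leftShift E f n = f (n + 1) := rfl

@[simp]
theorem rightShift_apply_zero (f : lp (fun _ : ℕ => E) 2) :
    rightShift E f 0 = 0 := rfl

@[simp]
theorem rightShift_apply_succ (f : lp (fun _ : ℕ => E) 2) (n : ℕ) :
    rightShift E f (n + 1) = f n := rfl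

end Shift

/-! ### Infinite-dimensional Hilbert spaces absorb countable sums -/

open Cardinal in
theorem nonempty_linearIsometryEquiv_lp_nat {H : Type*} [NormedAddCommGroup H]
    [InnerProductSpace ℂ H] [CompleteSpace H] (hH : ¬ FiniteDimensional ℂ H) :
    Nonempty (H ≃ₗᵢ[ℂ] lp (fun _ : ℕ => H) 2) := by
  classical
  obtain ⟨ι, b, -⟩ := exists_hilbertBasis ℂ H
  have : Infinite ι := by
    by_contra h
    rw [not_infinite_iff_finite] at h
    have := Fintype.ofFinite ι
    exact hH (Module.Finite.of_basis b.toOrthonormalBasis.toBasis)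
  obtain ⟨φ⟩ : Nonempty (ι ≃ ℕ × ι) := Cardinal.eq.1 (by
    rw [mk_prod, lift_uzero, mk_nat, lift_aleph0, aleph0_mul_eq (aleph0_le_mk ι)])
  -- The vectors `b j` placed in position `n` form a Hilbert basis of the sequence space; by `φ` it
  -- has the same index set as `b`.
  have hb : Orthonormal ℂ (fun i => lp.single (E := fun _ : ℕ => H) 2 (φ i).1 (b (φ i).2)) := by
    rw [orthonormal_iff_ite]
    intro i j
    rw [lp.inner_single_left, lp.single_apply]
    by_cases h1 : (φ i).1 = (φ j).1
    · rw [h1, Pi.single_eq_same, orthonormal_iff_ite.1 b.orthonormal]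
      refine if_congr ⟨fun h2 => φ.injective (Prod.ext h1 h2), fun h => by rw [h]⟩ rfl rfl
    · rw [Pi.single_eq_of_ne h1, inner_zero_right, if_neg fun h => h1 (by rw [h])]
  have hb' : (Submodule.span ℂ
      (Set.range fun i => lp.single (E := fun _ : ℕ => H) 2 (φ i).1 (b (φ i).2)))ᗮ = ⊥ := by
    rw [Submodule.eq_bot_iff]
    intro f hf
    ext n
    change f n = 0
    apply b.repr.injective
    ext i
    rw [b.repr_apply_apply]
    have := (Submodule.mem_orthogonal _ _).1 hf _ (Submodule.subset_span ⟨φ.symm (n, i), rfl⟩)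
    simpa [lp.inner_single_left] using this
  exact ⟨b.repr.trans (HilbertBasis.mkOfOrthogonalEqBot hb hb').repr.symm⟩

/-- Under `H ≃ ℓ²(ℕ, H)` the family consists of the zeroth coordinate and the shifts, and `d` is the
diagonal operator `diag (a, a, …)`. -/
theorem exists_cuntzFamily {H : Type*} [NormedAddCommGroup H] [InnerProductSpace ℂ H]
    [CompleteSpace H] (hH : ¬ FiniteDimensional ℂ H) :
    ∃ c : CuntzFamily (Fin 2) (H →L[ℂ] H),
      ∀ a, ∃ d, d = c.s 0 * a * c.t 0 + c.s 1 * d * c.t 1 := by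
  obtain ⟨e'⟩ := nonempty_linearIsometryEquiv_lp_nat hH
  let e : H ≃L[ℂ] lp (fun _ : ℕ => H) 2 := e'.toContinuousLinearEquiv
  let ei : lp (fun _ : ℕ => H) 2 →L[ℂ] H := e.symm
  let ef : H →L[ℂ] lp (fun _ : ℕ => H) 2 := e
  have hfi (x) : ef (ei x) = x := e.apply_symm_apply x
  have hev (f : lp (fun _ : ℕ => H) 2) : lp.evalCLM ℂ (fun _ : ℕ => H) 2 0 f = f 0 := rfl
  have hinj : Function.Injective ef := e.injective
  refine ⟨⟨![ei ∘L lp.singleContinuousLinearMap ℂ (fun _ : ℕ => H) 2 0, ei ∘L rightShift H ∘L ef],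
    ![lp.evalCLM ℂ (fun _ : ℕ => H) 2 0 ∘L ef, ei ∘L leftShift H ∘L ef], ?_, ?_⟩, fun a => ?_⟩
  · intro i j
    fin_cases i <;> fin_cases j
    · ext x
      simp [hfi, hev]
    · ext x
      simp [hfi, hev]
    · ext x
      apply hinj
      ext n
      simp [hfi]
    · ext x
      apply hinj
      ext n
      simp [hfi]
  · ext x
    apply hinj
    ext n
    cases n <;> simp [hfi, hev]
  · refine ⟨ei ∘L lp.mapCLM 2 (fun _ => a) (norm_nonneg a) (fun _ => le_rfl) ∘L ef, ?_⟩
    ext x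
    apply hinj
    ext n
    cases n <;> simp [hfi, hev]

/-! ### Cube roots of the identity -/

theorem prod_X_sub_C_cube_roots {ω : ℂ} (hω : 1 + ω + ω ^ 2 = 0) :
    (∏ i, (X - C ((![1, ω, ω ^ 2] : Fin 3 → ℂ) i))) = X ^ 3 - 1 := by
  have h : (1 : ℂ[X]) + C ω + C ω ^ 2 = 0 := by
    rw [← C_1, ← C_pow, ← C_add, ← C_add, hω, C_0]
  simp only [Fin.prod_univ_three, Matrix.cons_val, C_pow, C_1]
  linear_combination (-X ^ 2 + C ω * X - (C ω - 1)) * h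

theorem exists_continuousLinearEquiv_orderOf_eq_three {𝕜 E : Type*} [NontriviallyNormedField 𝕜]
    [NormedAddCommGroup E] [NormedSpace 𝕜 E] (N : E →L[𝕜] E) (h : N ^ 3 = 1) (h1 : N ≠ 1) :
    ∃ U : E ≃L[𝕜] E, orderOf U = 3 ∧ (U : E →L[𝕜] E) = N := by
  have : Fact (Nat.Prime 3) := ⟨Nat.prime_three⟩
  refine ⟨ContinuousLinearEquiv.unitsEquiv 𝕜 E (Units.ofPowEqOne N 3 h three_ne_zero), ?_, rfl⟩
  rw [MulEquiv.orderOf_eq, ← orderOf_units, Units.val_ofPowEqOne]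
  exact orderOf_eq_prime h h1

/-! ### Bounded operators as sums of four -/

theorem mainTheorem2 {H : Type*} [NormedAddCommGroup H] [InnerProductSpace ℂ H]
    [CompleteSpace H] (hH : ¬ FiniteDimensional ℂ H) (A : H →L[ℂ] H) :
    (∃ m : ℕ, 1 ≤ m ∧ m ≤ 4 ∧ ∃ N : Fin m → (H →L[ℂ] H),
      (∀ i, IsNilpotent (N i) ∧ nilpotencyClass (N i) ≤ 3) ∧ A = ∑ i, N i) ∧
    (∃ m : ℕ, 1 ≤ m ∧ m ≤ 4 ∧ ∃ U : Fin m → (H ≃L[ℂ] H),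
      (∀ i, orderOf (U i) = 3) ∧ A = ∑ i, (U i : H →L[ℂ] H)) := by
  obtain ⟨c, hc⟩ := exists_cuntzFamily hH
  have : Nontrivial H := by
    by_contra h
    rw [not_nontrivial_iff_subsingleton] at h
    exact hH inferInstance
  refine ⟨⟨4, by decide, le_rfl, ?_⟩, ⟨4, by decide, le_rfl, ?_⟩⟩
  · obtain ⟨N, hN, hA⟩ := c.exists_eq_sum_four hc (0 : Fin 3 → ℂ) A
    refine ⟨N, fun i => ?_, hA⟩
    have h : N i ^ 3 = 0 := by simpa using (hN i).1
    exact ⟨⟨3, h⟩, Nat.sInf_le h⟩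
  · obtain ⟨ω, hω⟩ : ∃ ω : ℂ, IsPrimitiveRoot ω 3 := ⟨_, Complex.isPrimitiveRoot_exp 3 (by decide)⟩
    have hsum : 1 + ω + ω ^ 2 = 0 := by
      simpa [Finset.sum_range_succ] using hω.geom_sum_eq_zero (by decide)
    obtain ⟨N, hN, hA⟩ := c.exists_eq_sum_four hc ![1, ω, ω ^ 2] A
    have hU (i) : ∃ U : H ≃L[ℂ] H, orderOf U = 3 ∧ (U : H →L[ℂ] H) = N i := by
      obtain ⟨h0, h1⟩ := hN i
      rw [prod_X_sub_C_cube_roots hsum] at h0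
      refine exists_continuousLinearEquiv_orderOf_eq_three _ (by simpa [sub_eq_zero] using h0) ?_
      simpa using h1 (by simpa using hω.ne_one (by decide))
        (by simpa using hω.pow_ne_one_of_pos_of_lt two_ne_zero (by decide))
    choose U hU hUN using hU
    exact ⟨U, hU, by simp only [hUN, hA]⟩
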